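/- Let $\Sigma$ be a finite alphabet. All languages are sets of nonempty words over $\Sigma$. For every language $L\subseteq\Sigma^+$, $L$ is accepted in real time by an iterative array if and only if $L$ is defined by a predecessor Horn formula with diagonal input-output; that is, $$\mathtt{RealTime_{IA}}=\mathtt{pred}\text{-}\mathtt{dio}\text{-}\mathtt{ESO}\text{-}\mathtt{HORN}.$$ *Iterative arrays.* An iterative array (IA) has a finite state set $Q$ with a set $Q_{accept}\subseteq Q$ of accepting states, two distinct distinguished states $\sharp$ (permanent) and $\lambda$ (quiescent), a transition function $\delta:Q^3\to Q$ with $\delta(\lambda,\lambda,\lambda)=\delta(\lambda,\lambda,\sharp)=\lambda$, and an input transition function $\delta_{input}:\Sigma\times Q^3\to Q$. On an input $w=w_1\dots w_n$, $n\ge 1$, the state $\langle c,t\rangle$ of cell $c\in\mathbb Z$ at time $t\ge 0$ is: $\langle c,t\rangle=\sharp$ for $c\notin[1,n]$; $\langle c,0\rangle=\lambda$ for $c\in[1,n]$; $\langle 1,t\rangle=\delta_{input}(w_t,\langle 0,t-1\rangle,\langle 1,t-1\rangle,\langle 2,t-1\rangle)$ for $1\le t\le n$; and $\langle c,t\rangle=\delta(\langle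 c-1,t-1\rangle,\langle c,t-1\rangle,\langle c+1,t-1\rangle)$ for all other $c\in[1,n]$, $t\ge 1$. The language accepted in real time is the set of all $w\in\Sigma^+$ such that $\langle 1,n\rangle\in Q_{accept}$, where $n=|w|$. $\mathtt{RealTime_{IA}}$ is the class of the languages accepted in real time by iterative arrays. *Logic.* A word $w=w_1\dots w_n$, $n\ge1$, is encoded by the structure $\langle w\rangle$ of domain $[1,n]$ with the monadic predicates $Q_s(i)\iff w_i=s$ ($s\in\Sigma$), $\mathtt{min}(i)\iff i=1$, $\mathtt{max}(i)\iff i=n$, and the predecessor function with $\mathtt{pred}(i)=i-1$ for $i>1$ and $\mathtt{pred}(1)=1$; $v-a$ denotes $\mathtt{pred}^a(v)$. A predecessor Horn formula with diagonal input-output is a formula $\exists\mathbf R\,\forall x\,\forall y\,\psi(x,y)$, where $\mathbf R$ is a finite set of binary predicates and $\psi$ is a finite conjunction of clauses $\delta_1\wedge\dots\wedge\delta_r\to\delta_0$ in which $\delta_0$ is $R(x,y)$ with $R\in\mathbf R$, or $\bot$, and each $\delta_i$, $i\ge1$, has one of the following forms, with integers $a,b\ge 0$: $Q_s(x-a)\wedge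 x=y$ with $s\in\Sigma$; $U(x-a)$, $\neg U(x-a)$, $U(y-a)$ or $\neg U(y-a)$ with $U\in\{\mathtt{min},\mathtt{max}\}$; $S(x-a,y-b)$ or $S(y-b,x-a)$ with $S\in\mathbf R$. It defines the language of all $w\in\Sigma^+$ such that $\langle w\rangle$ satisfies it, and $\mathtt{pred}$-$\mathtt{dio}$-$\mathtt{ESO}$-$\mathtt{HORN}$ is the class of the languages so defined. -/

import Mathlib

/-! ### Iterative arrays working in real time -/

/-- A one-dimensional iterative array over the input alphabet `A`: finite state set, permanent
state `sharp` (outside the array), quiescent state `quiescent`, accepting states, neighborhood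
`{-1, 0, 1}` and two transition functions, whose state arguments are the states of the left
neighbor, of the cell itself and of the right neighbor at the previous time step.
`delta` is the ordinary transition function; `deltaInput` is the transition function of the first
cell while it is fed with the letters of the input. -/
structure IterativeArray (A : Type*) where
  State : Type
  finite_state : Finite State
  sharp : State
  quiescent : State
  sharp_ne_quiescent : sharp ≠ quiescent
  accept : Set State
  delta : State → State → State → State
  deltaInput : A → State → State → State → State
  /-- A cell stays quiescent as long as no information from the input has reached it. -/
  delta_quiescent : delta quiescent quiescent quiescent = quiescent
  /-- The same for the last cell, whose right neighbor is outside the array. -/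
  delta_quiescent_border : delta quiescent quiescent sharp = quiescent

namespace IterativeArray

variable {A : Type*} (M : IterativeArray A)

/-- `M.state w t c` is the state of the cell `c` at time `t` on the input `w` of length `n`.
The cells outside `[1, n]` are always in the state `sharp`; before the first letter is read (time
`0`) the cells of `[1, n]` are quiescent; for `1 ≤ i ≤ n` the `i`-th letter is given to the first
cell at time `i`. -/
def state (w : List A) : ℕ → ℤ → M.State
  | 0, c => if 1 ≤ c ∧ c ≤ (w.length : ℤ) then M.quiescent else M.sharp
  | t + 1, c =>
    if 1 ≤ c ∧ c ≤ (w.length : ℤ) then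
      match w[t]?, decide (c = 1) with
      | some a, true =>
        M.deltaInput a (state w t (c - 1)) (state w t c) (state w t (c + 1))
      | _, _ => M.delta (state w t (c - 1)) (state w t c) (state w t (c + 1))
    else M.sharp

/-- The language accepted in real time: the nonempty words `w` such that the first cell is in an
accepting state at time `|w|`, that is, immediately when it gets the last letter of `w`. -/
def realTimeLanguage : Language A :=
  {w | w ≠ [] ∧ M.state w w.length 1 ∈ M.accept}

end IterativeArray

/-- The class of languages of nonempty words over `A` accepted by iterative arrays in real time. -/
def RealTimeIA (A : Type*) : Set (Language A) :=
  {L | ∃ M : IterativeArray A, L = M.realTimeLanguage}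

/-! ### The structure encoding a word

The domain `[1, n]` is represented by `Fin n` (so the position `i` of the word is `i - 1`). -/

namespace WordStructure

variable {A : Type*} (w : List A)

/-- `Q_s(i)`: the letter at position `i` is `s`. -/
def Letter (s : A) (i : Fin w.length) : Prop := w.get i = s

/-- `min(i)`: `i` is the first position. -/
def IsMin (i : Fin w.length) : Prop := (i : ℕ) = 0

/-- `max(i)`: `i` is the last position. -/
def IsMax (i : Fin w.length) : Prop := (i : ℕ) + 1 = w.length

/-- The predecessor function; the predecessor of the first position is the first position. -/
def pred (i : Fin w.length) : Fin w.length :=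
  ⟨(i : ℕ) - 1, lt_of_le_of_lt (Nat.sub_le _ _) i.isLt⟩

/-- The value of the term `i - a`, the `a`-fold iterate of the predecessor function. -/
def sub (i : Fin w.length) (a : ℕ) : Fin w.length := (pred w)^[a] i

end WordStructure

/-! ### Predecessor Horn formulas with diagonal input-output -/

/-- The two first-order variables. -/
inductive HornVar
  | x
  | y

/-- The two input predicates `min` and `max`. -/
inductive Extremum
  | min
  | max

/-- The hypotheses that may occur in a clause of a predecessor Horn formula with diagonal
input-output, where `A` is the alphabet and `P` the set of computation predicates. -/
inductive DioHyp (A : Type*) (P : Type)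
  /-- `Q_s(x - a) ∧ x = y` -/
  | letter (s : A) (a : ℕ)
  /-- `U(v - a)` for `U ∈ {min, max}` and `v ∈ {x, y}` -/
  | pos (U : Extremum) (v : HornVar) (a : ℕ)
  /-- `¬ U(v - a)` for `U ∈ {min, max}` and `v ∈ {x, y}` -/
  | neg (U : Extremum) (v : HornVar) (a : ℕ)
  /-- `S(x - a, y - b)` -/
  | comp (S : P) (a b : ℕ)
  /-- `S(y - b, x - a)` -/
  | compSwap (S : P) (b a : ℕ)

/-- The conclusion of a clause. -/
inductive DioConclusion (P : Type)
  /-- `R(x, y)` -/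
  | atom (R : P)
  /-- `⊥` -/
  | falsum

/-- A Horn clause `δ₁ ∧ ... ∧ δᵣ → δ₀`. -/
structure DioClause (A : Type*) (P : Type) where
  hyps : List (DioHyp A P)
  concl : DioConclusion P

/-- A predecessor Horn formula with diagonal input-output `∃ R, ∀ x, ∀ y, ψ(x, y)`: a finite set of
binary computation predicates, and a finite conjunction `ψ` of clauses. -/
structure DioFormula (A : Type*) where
  Pred : Type
  finite_pred : Finite Pred
  clauses : List (DioClause A Pred)

section Semantics

variable {A : Type*} {P : Type} (w : List A)

/-- The truth of `U(i)` for `U ∈ {min, max}`. -/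
def Extremum.Holds (i : Fin w.length) : Extremum → Prop
  | .min => WordStructure.IsMin w i
  | .max => WordStructure.IsMax w i

/-- The value of a variable. -/
def HornVar.value {D : Type} (i j : D) : HornVar → D
  | .x => i
  | .y => j

/-- The truth of a hypothesis for `x = i` and `y = j`, the computation predicates being
interpreted by `R`. -/
def DioHyp.Holds (R : P → Fin w.length → Fin w.length → Prop) (i j : Fin w.length) :
    DioHyp A P → Prop
  | .letter s a => WordStructure.Letter w s (WordStructure.sub w i a) ∧ i = j
  | .pos U v a => U.Holds w (WordStructure.sub w (v.value i j) a)
  | .neg U v a => ¬ U.Holds w (WordStructure.sub w (v.value i j) a)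
  | .comp S a b => R S (WordStructure.sub w i a) (WordStructure.sub w j b)
  | .compSwap S b a => R S (WordStructure.sub w j b) (WordStructure.sub w i a)

/-- The truth of a conclusion. -/
def DioConclusion.Holds (R : P → Fin w.length → Fin w.length → Prop) (i j : Fin w.length) :
    DioConclusion P → Prop
  | .atom S => R S i j
  | .falsum => False

/-- The truth of a clause. -/
def DioClause.Holds (R : P → Fin w.length → Fin w.length → Prop) (i j : Fin w.length)
    (C : DioClause A P) : Prop :=
  (∀ h ∈ C.hyps, h.Holds w R i j) → C.concl.Holds w R i j

/-- The structure encoding `w` satisfies the formula `Φ`. -/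
def DioFormula.Satisfied (Φ : DioFormula A) : Prop :=
  ∃ R : Φ.Pred → Fin w.length → Fin w.length → Prop,
    ∀ i j : Fin w.length, ∀ C ∈ Φ.clauses, C.Holds w R i j

end Semantics

/-- The language of nonempty words defined by a formula. -/
def DioFormula.language {A : Type*} (Φ : DioFormula A) : Language A :=
  {w | w ≠ [] ∧ Φ.Satisfied w}

/-- The class `pred-dio-ESO-HORN` of languages of nonempty words over `A`. -/
def PredDioESOHorn (A : Type*) : Set (Language A) :=
  {L | ∃ Φ : DioFormula A, L = Φ.language}

/-! ### Terms and positions -/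

/-! Both inclusions rest on one change of coordinates: cell `c` at time `t` corresponds to the point
`(x, y) = (t - c + 1, t + c - 1)` with `x ≤ y`. The input cell runs along the diagonal, where
formulas read letters, and the real-time output is the corner `(n, n)`.

From arrays to formulas, the states of cells `c - 1`, `c`, `c + 1` one step earlier sit at `(x, y -
2)`, `(x - 1, y - 1)`, `(x - 2, y)`, so a transition is a Horn clause. Every model contains the true
run (`Context.complete`), and the true run is itself a model when the array accepts
(`Context.sound`).

From formulas to arrays, a Horn formula holds iff its least model omits `⊥` (`satisfied_iff`). Terms
only subtract bounded amounts, so the least model can be computed locally: a finite window around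
`(x, y)` is determined by those at `(x - 1, y)` and `(x, y - 1)` inside the half-plane, and by that
at `(x - 1, x)` plus a letter on the diagonal (`SameWindow.inner`, `SameWindow.diagonal`). Recording
atoms at both `(x, y)` and `(y, x)` folds the square onto `x ≤ y`. The array does not know `n` in
advance, so a window keeps two least models: one with no last position and one whose last position
is `y`. The second is the right one at the corner. `mem_realTimeIA_of_grid` turns any such grid
recursion into an array. -/

theorem WordStructure.val_sub {A : Type*} (w : List A) (i : Fin w.length) (a : ℕ) :
    (WordStructure.sub w i a : ℕ) = i - a := by
  induction a with
  | zero => rfl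
  | succ a ih =>
    have h : (WordStructure.sub w i (a + 1) : ℕ) = (WordStructure.sub w i a : ℕ) - 1 := by
      simp only [WordStructure.sub, Function.iterate_succ_apply']
      rfl
    rw [h, ih]; omega

/-! ### From iterative arrays to formulas -/

namespace IterativeArray

variable {A : Type*} (M : IterativeArray A)

theorem state_of_outside (w : List A) (t : ℕ) {c : ℤ} (hc : ¬ (1 ≤ c ∧ c ≤ (w.length : ℤ))) :
    M.state w t c = M.sharp := by
  cases t <;> simp only [state, if_neg hc]

theorem state_succ_one (w : List A) {t : ℕ} (ht : t < w.length) :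
    M.state w (t + 1) 1 =
      M.deltaInput w[t] M.sharp (M.state w t 1) (M.state w t 2) := by
  have h0 : M.state w t (1 - 1) = M.sharp := M.state_of_outside w t (by omega)
  have h : (1 : ℤ) ≤ 1 ∧ (1 : ℤ) ≤ (w.length : ℤ) := by omega
  rw [state, if_pos h, h0]
  simp [List.getElem?_eq_getElem ht]

theorem state_succ_of_ne_one (w : List A) (t : ℕ) {c : ℤ} (hc : 1 ≤ c ∧ c ≤ (w.length : ℤ))
    (h1 : c ≠ 1) :
    M.state w (t + 1) c =
      M.delta (M.state w t (c - 1)) (M.state w t c) (M.state w t (c + 1)) := by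
  rw [state, if_pos hc]
  simp only [h1, decide_false]
  split <;> simp_all

theorem state_quiescent (w : List A) (t : ℕ) {c : ℤ} (h : (t : ℤ) < c)
    (hc : c ≤ (w.length : ℤ)) : M.state w t c = M.quiescent := by
  induction t generalizing c with
  | zero => rw [state, if_pos ⟨by omega, hc⟩]
  | succ t ih =>
    rw [state_succ_of_ne_one M w t ⟨by omega, hc⟩ (by omega), ih (by omega) (by omega),
      ih (by omega) hc]
    by_cases hn : c + 1 ≤ (w.length : ℤ)
    · rw [ih (by omega) hn, M.delta_quiescent]
    · rw [state_of_outside M w t (by omega), M.delta_quiescent_border]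

/-- Hypotheses that describe, at the point `(x, y)` representing the cell `c` at time `t`, the
states of the cells `c` and `c + 1` at time `t - 1`. -/
inductive Context : List (DioHyp A M.State) → M.State → M.State → Prop
  | first : Context [.pos .min .x 0, .neg .max .x 0] M.quiescent M.quiescent
  | single : Context [.pos .min .x 0, .pos .max .x 0] M.quiescent M.sharp
  | second (q : M.State) :
      Context [.neg .min .x 0, .pos .min .x 1, .comp q 1 1] q M.quiescent
  | later (q r : M.State) : Context [.neg .min .x 1, .comp q 1 1, .comp r 2 0] q r

/-- The clauses describing the computation of an iterative array. The cell `c` at time `t` is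
represented by the point `(t - c + 1, t + c - 1)`. -/
inductive IsClause : DioClause A M.State → Prop
  | input (s : A) {l : List (DioHyp A M.State)} {q r : M.State} (h : M.Context l q r) :
      IsClause ⟨.letter s 0 :: l, .atom (M.deltaInput s M.sharp q r)⟩
  | inner (p : M.State) {l : List (DioHyp A M.State)} {q r : M.State} (h : M.Context l q r) :
      IsClause ⟨.neg .min .y 1 :: .comp p 0 2 :: l, .atom (M.delta p q r)⟩
  | reject (q : M.State) (h : q ∉ M.accept) :
      IsClause ⟨[.pos .max .x 0, .pos .max .y 0, .comp q 0 0], .falsum⟩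

theorem finite_context :
    {x : List (DioHyp A M.State) × M.State × M.State | M.Context x.1 x.2.1 x.2.2}.Finite := by
  have := M.finite_state
  have h1 := Set.finite_range fun q : M.State =>
    (([.neg .min .x 0, .pos .min .x 1, .comp q 1 1], q, M.quiescent) :
      List (DioHyp A M.State) × M.State × M.State)
  have h2 := Set.finite_range fun q : M.State × M.State =>
    (([.neg .min .x 1, .comp q.1 1 1, .comp q.2 2 0], q.1, q.2) :
      List (DioHyp A M.State) × M.State × M.State)
  refine (((h1.union h2).insert
    ([.pos .min .x 0, .neg .max .x 0], M.quiescent, M.quiescent)).insert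
    ([.pos .min .x 0, .pos .max .x 0], M.quiescent, M.sharp)).subset ?_
  rintro ⟨l, q, r⟩ h
  simp only [Set.mem_ofPred_eq] at h
  cases h <;> simp

theorem finite_isClause [Finite A] : {C | M.IsClause C}.Finite := by
  have := M.finite_state
  have hc := M.finite_context
  have h1 := ((Set.finite_univ (α := A)).prod hc).image
    fun z => (⟨.letter z.1 0 :: z.2.1, .atom (M.deltaInput z.1 M.sharp z.2.2.1 z.2.2.2)⟩ :
      DioClause A M.State)
  have h2 := ((Set.finite_univ (α := M.State)).prod hc).image
    fun z => (⟨.neg .min .y 1 :: .comp z.1 0 2 :: z.2.1, .atom (M.delta z.1 z.2.2.1 z.2.2.2)⟩ :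
      DioClause A M.State)
  have h3 := Set.finite_range fun q : M.State =>
    (⟨[.pos .max .x 0, .pos .max .y 0, .comp q 0 0], .falsum⟩ : DioClause A M.State)
  refine ((h1.union h2).union h3).subset ?_
  intro C h
  cases h with
  | @input s l q r h => exact .inl (.inl ⟨(s, l, q, r), ⟨trivial, h⟩, rfl⟩)
  | @inner p l q r h => exact .inl (.inr ⟨(p, l, q, r), ⟨trivial, h⟩, rfl⟩)
  | reject q h => exact .inr ⟨q, rfl⟩

/-- The formula describing the computation of an iterative array. -/
noncomputable def toFormula [Finite A] : DioFormula A where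
  Pred := M.State
  finite_pred := M.finite_state
  clauses := M.finite_isClause.toFinset.toList

theorem mem_clauses_toFormula [Finite A] {C : DioClause A M.State} :
    C ∈ M.toFormula.clauses ↔ M.IsClause C :=
  Finset.mem_toList.trans M.finite_isClause.mem_toFinset

/-- The intended interpretation of the predicates of `toFormula`. -/
def intended (w : List A) (q : M.State) (i j : Fin w.length) : Prop :=
  ∃ d : ℕ, (j : ℕ) = i + 2 * d ∧ M.state w (i + d + 1) (d + 1) = q

/-- With zero-based `i` and `j`, the point stands for cell `d + 1` at time `i + d + 1`. For `i ≤ 1`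
some of the states needed lie before the signal from the input, or outside the array, and are known
without consulting an atom. -/
theorem Context.sound {w : List A} {i j : Fin w.length} {d : ℕ} (hd : (j : ℕ) = i + 2 * d)
    {l : List (DioHyp A M.State)} {q r : M.State} (hl : M.Context l q r)
    (h : ∀ φ ∈ l, φ.Holds w (M.intended w) i j) :
    q = M.state w (i + d) (d + 1) ∧ r = M.state w (i + d) (d + 1 + 1) := by
  have hi := i.isLt
  have hj := j.isLt
  cases hl with
  | first =>
    simp [DioHyp.Holds, Extremum.Holds, WordStructure.IsMin, WordStructure.IsMax,
      WordStructure.val_sub, HornVar.value] at h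
    exact ⟨(M.state_quiescent w _ (by omega) (by omega)).symm,
      (M.state_quiescent w _ (by omega) (by omega)).symm⟩
  | single =>
    simp [DioHyp.Holds, Extremum.Holds, WordStructure.IsMin, WordStructure.IsMax,
      WordStructure.val_sub, HornVar.value] at h
    exact ⟨(M.state_quiescent w _ (by omega) (by omega)).symm,
      (M.state_of_outside w _ (by omega)).symm⟩
  | second =>
    simp [DioHyp.Holds, Extremum.Holds, WordStructure.IsMin,
      WordStructure.val_sub, HornVar.value, intended] at h
    obtain ⟨h1, h2, e, he, rfl⟩ := h
    obtain rfl : e = d := by omega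
    refine ⟨?_, (M.state_quiescent w _ (by omega) (by omega)).symm⟩
    congr 1; omega
  | later =>
    simp [DioHyp.Holds, Extremum.Holds, WordStructure.IsMin,
      WordStructure.val_sub, HornVar.value, intended] at h
    obtain ⟨h1, ⟨e, he, rfl⟩, e', he', rfl⟩ := h
    obtain rfl : e = d := by omega
    obtain rfl : e' = e + 1 := by omega
    refine ⟨by congr 1; omega, ?_⟩
    congr 1
    · omega

/-- The cases `i = 0`, `i = 1`, `i ≥ 2` are exhaustive. Since `i + 2 * d < n`, cell `d + 2` lies
inside the array unless `n = 1`, so the right border matters only for `single`. -/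
theorem Context.complete {w : List A} {i j : Fin w.length} {d : ℕ} (hd : (j : ℕ) = i + 2 * d)
    {R : M.State → Fin w.length → Fin w.length → Prop}
    (hR : ∀ (i' j' : Fin w.length) (e : ℕ), (j' : ℕ) = i' + 2 * e → (i' : ℕ) + e < i + d →
      R (M.state w (i' + e + 1) (e + 1)) i' j') :
    ∃ l, M.Context l (M.state w (i + d) (d + 1)) (M.state w (i + d) (d + 1 + 1)) ∧
      ∀ φ ∈ l, φ.Holds w R i j := by
  have hi := i.isLt
  have hj := j.isLt
  have hm (h : 1 ≤ (i : ℕ)) : R (M.state w (i + d) (d + 1)) (WordStructure.sub w i 1)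
      (WordStructure.sub w j 1) := by
    have h' := hR (WordStructure.sub w i 1) (WordStructure.sub w j 1) d
      (by simp only [WordStructure.val_sub]; omega)
      (by simp only [WordStructure.val_sub]; omega)
    rwa [WordStructure.val_sub, show (i : ℕ) - 1 + d + 1 = i + d by omega] at h'
  have hr (h : 2 ≤ (i : ℕ)) : R (M.state w (i + d) (d + 1 + 1)) (WordStructure.sub w i 2)
      (WordStructure.sub w j 0) := by
    have h' := hR (WordStructure.sub w i 2) (WordStructure.sub w j 0) (d + 1)
      (by simp only [WordStructure.val_sub]; omega)
      (by simp only [WordStructure.val_sub]; omega)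
    rwa [WordStructure.val_sub, show (i : ℕ) - 2 + (d + 1) + 1 = i + d by omega,
      Nat.cast_succ] at h'
  rcases Nat.lt_or_ge i 2 with h2 | h2
  · rcases Nat.eq_zero_or_pos i with h0 | h1
    · have hq := M.state_quiescent w (i + d) (c := d + 1) (by omega) (by omega)
      by_cases hn : w.length = 1
      · rw [hq, M.state_of_outside w (i + d) (c := d + 1 + 1) (by omega)]
        refine ⟨_, .single, ?_⟩
        simp [DioHyp.Holds, Extremum.Holds, WordStructure.IsMin, WordStructure.IsMax,
          WordStructure.val_sub, HornVar.value]
        omega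
      · rw [hq, M.state_quiescent w (i + d) (c := d + 1 + 1) (by omega) (by omega)]
        refine ⟨_, .first, ?_⟩
        simp [DioHyp.Holds, Extremum.Holds, WordStructure.IsMin, WordStructure.IsMax,
          WordStructure.val_sub, HornVar.value]
        omega
    · rw [M.state_quiescent w (i + d) (c := d + 1 + 1) (by omega) (by omega)]
      refine ⟨_, .second _, ?_⟩
      simp [DioHyp.Holds, Extremum.Holds, WordStructure.IsMin,
        WordStructure.val_sub, HornVar.value]
      exact ⟨by omega, by omega, hm h1⟩
  · refine ⟨_, .later _ _, ?_⟩
    simp [DioHyp.Holds, Extremum.Holds, WordStructure.IsMin,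
      WordStructure.val_sub, HornVar.value]
    exact ⟨by omega, hm (by omega), hr h2⟩

theorem satisfied_toFormula_iff [Finite A] {w : List A} (hw : w ≠ []) :
    M.toFormula.Satisfied w ↔ M.state w w.length 1 ∈ M.accept := by
  have hn : 0 < w.length := List.length_pos_iff.2 hw
  constructor
  · rintro ⟨R, hR⟩
    -- Induction on time: `N + 1` is the time represented by the point, so every atom consulted has
    -- a smaller `N`.
    have key (N : ℕ) : ∀ (i j : Fin w.length) (d : ℕ), (j : ℕ) = i + 2 * d → (i : ℕ) + d = N →
        R (M.state w (i + d + 1) (d + 1)) i j := by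
      induction N using Nat.strong_induction_on with
      | _ N ih =>
        intro i j d hd hN
        obtain ⟨l, hl, hh⟩ := Context.complete M hd (R := R)
          fun i' j' e he hlt => ih _ (by omega) i' j' e he rfl
        rcases Nat.eq_zero_or_pos d with rfl | hpos
        · have hij : i = j := Fin.ext (by omega)
          have h := hR i j _ (M.mem_clauses_toFormula.2 (.input w[(i : ℕ)] hl))
          have h' := h (by
            intro φ hφ
            rcases List.mem_cons.1 hφ with rfl | hφ
            · exact ⟨rfl, hij⟩
            · exact hh φ hφ)
          have e := M.state_succ_one w i.isLt
          simpa [DioConclusion.Holds, e] using h'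
        · have h := hR i j _ (M.mem_clauses_toFormula.2 (.inner (M.state w (i + d) d) hl))
          have h' := h (by
            intro φ hφ
            rcases List.mem_cons.1 hφ with rfl | hφ
            · simp [DioHyp.Holds, Extremum.Holds, WordStructure.IsMin,
                WordStructure.val_sub, HornVar.value]
              omega
            rcases List.mem_cons.1 hφ with rfl | hφ
            · have := ih (i + d - 1) (by omega) (WordStructure.sub w i 0)
                (WordStructure.sub w j 2) (d - 1)
                (by simp only [WordStructure.val_sub]; omega)
                (by simp only [WordStructure.val_sub]; omega)
              rwa [WordStructure.val_sub, show (i : ℕ) - 0 + (d - 1) + 1 = i + d by omega,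
                show ((d - 1 : ℕ) : ℤ) + 1 = d by omega] at this
            · exact hh φ hφ)
          have e := M.state_succ_of_ne_one w (i + d) (c := d + 1) (by omega) (by omega)
          rw [e]
          simpa [DioConclusion.Holds] using h'
    by_contra hna
    have h := hR ⟨w.length - 1, by omega⟩ ⟨w.length - 1, by omega⟩ _
      (M.mem_clauses_toFormula.2 (.reject _ hna))
    refine h ?_
    have := key _ ⟨w.length - 1, by omega⟩ ⟨w.length - 1, by omega⟩ 0 rfl rfl
    have e : w.length - 1 + 0 + 1 = w.length := by omega
    simp only [e, Nat.cast_zero, zero_add] at this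
    refine List.forall_mem_cons.2 ⟨?_, List.forall_mem_cons.2 ⟨?_, List.forall_mem_cons.2
      ⟨?_, fun _ h => absurd h List.not_mem_nil⟩⟩⟩
    · exact e
    · exact e
    · exact this
  · intro hacc
    refine ⟨M.intended w, fun i j C hC => ?_⟩
    have hi := i.isLt
    have hj := j.isLt
    cases M.mem_clauses_toFormula.1 hC with
    | @input s l q r hl =>
      intro h
      obtain ⟨hs, rfl⟩ := h _ List.mem_cons_self
      obtain ⟨rfl, rfl⟩ := Context.sound M (d := 0) rfl hl
        fun φ hφ => h φ (List.mem_cons_of_mem _ hφ)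
      refine ⟨0, rfl, ?_⟩
      have e := M.state_succ_one w i.isLt
      have hs' : w[(i : ℕ)] = s := hs
      rw [hs'] at e
      simpa using e
    | @inner p l q r hl =>
      intro h
      have h1 := h _ List.mem_cons_self
      obtain ⟨e, he, rfl⟩ := h _ (List.mem_cons_of_mem _ List.mem_cons_self)
      simp [DioHyp.Holds, Extremum.Holds, WordStructure.IsMin,
        WordStructure.val_sub, HornVar.value] at h1 he
      have hd : (j : ℕ) = i + 2 * (e + 1) := by omega
      obtain ⟨rfl, rfl⟩ := Context.sound M hd hl
        fun φ hφ => h φ (List.mem_cons_of_mem _ (List.mem_cons_of_mem _ hφ))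
      refine ⟨e + 1, hd, ?_⟩
      rw [state_succ_of_ne_one M w (i + (e + 1)) (by push_cast; omega) (by push_cast; omega)]
      simp [WordStructure.val_sub, Nat.add_assoc]
    | reject q hq =>
      intro h
      have h1 : (i : ℕ) + 1 = w.length := h _ List.mem_cons_self
      have h2 : (j : ℕ) + 1 = w.length := h _ (List.mem_cons_of_mem _ List.mem_cons_self)
      obtain ⟨d, hd, rfl⟩ := h _ (List.mem_cons_of_mem _ (List.mem_cons_of_mem _ List.mem_cons_self))
      simp only [WordStructure.val_sub, Nat.sub_zero] at hd
      obtain rfl : d = 0 := by omega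
      refine hq ?_
      convert hacc using 2
      · simpa [WordStructure.val_sub] using h1
      · simp

end IterativeArray

theorem realTimeIA_subset_predDioESOHorn (A : Type*) [Finite A] :
    RealTimeIA A ⊆ PredDioESOHorn A := by
  rintro _ ⟨M, rfl⟩
  refine ⟨M.toFormula, ?_⟩
  ext w
  exact and_congr_right fun hw => (M.satisfied_toFormula_iff hw).symm

/-! ### From grid computations to iterative arrays -/

/-- Let `H w x y`, for `x ≤ y`, take its values in a finite set, be constant for `x = 0`, be
determined by `H w (x - 1) y` and `H w x (y - 1)` if `x < y`, and by `H w (x - 1) x` and the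
`x`-th letter of `w` if `0 < x = y`. Then the language of nonempty words `w` given by a condition
on `H w |w| |w|` is accepted in real time by an iterative array. -/
theorem mem_realTimeIA_of_grid {A : Type*} {Γ : Type*} [Finite Γ]
    (H : List A → ℕ → ℕ → Γ)
    (hzero : ∀ w w' y y', H w 0 y = H w' 0 y')
    (hinner : ∀ w w' x x' y y', x < y → x' < y' → H w (x - 1) y = H w' (x' - 1) y' →
      H w x (y - 1) = H w' x' (y' - 1) → H w x y = H w' x' y')
    (hdiag : ∀ w w' x x', x < w.length → x' < w'.length → w[x]? = w'[x']? →
      H w x (x + 1) = H w' x' (x' + 1) → H w (x + 1) (x + 1) = H w' (x' + 1) (x' + 1))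
    (Acc : Set Γ) : {w | w ≠ [] ∧ H w w.length w.length ∈ Acc} ∈ RealTimeIA A := by
  classical
  -- States must live in `Type`, whereas `Γ` may lie in any universe; hence the encoding by `Fin k`.
  obtain ⟨k, ⟨e⟩⟩ := Finite.exists_equiv_fin Γ
  let E (w : List A) (x y : ℕ) : Fin k := e (H w x y)
  let q₀ : Fin k := E [] 0 0
  have hE0 (w : List A) (y : ℕ) : E w 0 y = q₀ := congrArg e (hzero _ _ _ _)
  -- The hypotheses make the value a function of its two predecessors on the pairs that occur; on
  -- other pairs `f` is arbitrary.
  obtain ⟨f, hf⟩ : ∃ f : Fin k → Fin k → Fin k, ∀ w x y, x < y →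
      E w x y = f (E w (x - 1) y) (E w x (y - 1)) := by
    let ι := {z : List A × ℕ × ℕ // z.2.1 < z.2.2}
    let src : ι → Fin k × Fin k := fun z =>
      (E z.1.1 (z.1.2.1 - 1) z.1.2.2, E z.1.1 z.1.2.1 (z.1.2.2 - 1))
    let tgt : ι → Fin k := fun z => E z.1.1 z.1.2.1 z.1.2.2
    have hfac : tgt.FactorsThrough src := by
      rintro ⟨⟨w, x, y⟩, h⟩ ⟨⟨w', x', y'⟩, h'⟩ heq
      obtain ⟨h1, h2⟩ := Prod.mk.inj heq
      exact congrArg e (hinner _ _ _ _ _ _ h h' (e.injective h1) (e.injective h2))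
    exact ⟨fun a b => Function.extend src tgt (fun _ => q₀) (a, b), fun w x y h =>
      (hfac.extend_apply _ ⟨(w, x, y), h⟩).symm⟩
  obtain ⟨g, hg⟩ : ∃ g : A → Fin k → Fin k, ∀ (w : List A) (x : ℕ) (h : x < w.length),
      E w (x + 1) (x + 1) = g w[x] (E w x (x + 1)) := by
    let ι := {z : List A × ℕ // z.2 < z.1.length}
    let src : ι → Option A × Fin k := fun z => (z.1.1[z.1.2]?, E z.1.1 z.1.2 (z.1.2 + 1))
    let tgt : ι → Fin k := fun z => E z.1.1 (z.1.2 + 1) (z.1.2 + 1)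
    have hfac : tgt.FactorsThrough src := by
      rintro ⟨⟨w, x⟩, h⟩ ⟨⟨w', x'⟩, h'⟩ heq
      obtain ⟨h1, h2⟩ := Prod.mk.inj heq
      exact congrArg e (hdiag _ _ _ _ h h' h1 (e.injective h2))
    refine ⟨fun a b => Function.extend src tgt (fun _ => q₀) (some a, b), fun w x h => ?_⟩
    have := hfac.extend_apply (fun _ => q₀) ⟨(w, x), h⟩
    simp only [src, List.getElem?_eq_getElem h] at this
    exact this.symm
  have hfq : f q₀ q₀ = q₀ := by
    have := hf [] 0 1 one_pos
    simpa only [hE0] using this.symm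
  -- Reading `sharp` as `q₀` lets the invariant below cover cell `n + 1` at time `0`.
  let v : Option (Fin k) → Fin k := fun s => s.getD q₀
  let M : IterativeArray A :=
    { State := Option (Fin k)
      finite_state := inferInstance
      sharp := none
      quiescent := some q₀
      sharp_ne_quiescent := by simp
      accept := {s | e.symm (v s) ∈ Acc}
      -- Cells store only points with `x + y` even. One time step is two grid steps: the inner `f`s
      -- rebuild the two intermediate points of odd sum.
      delta := fun l c r => some (f (f (v r) (v c)) (f (v c) (v l)))
      deltaInput := fun a _ c r => some (g a (f (v r) (v c)))
      delta_quiescent := by simp [v, hfq]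
      delta_quiescent_border := by simp [v, hfq] }
  have key (w : List A) (t : ℕ) : ∀ c : ℕ, t + (c + 1) ≤ w.length + 1 →
      v (M.state w t (c + 1)) = E w (t - c) (t + c) := by
    induction t with
    | zero =>
      intro c hc
      rw [Nat.zero_sub, hE0]
      simp only [IterativeArray.state]
      split <;> rfl
    | succ t ih =>
      intro c hc
      have hin : (1 : ℤ) ≤ (c : ℤ) + 1 ∧ (c : ℤ) + 1 ≤ (w.length : ℤ) := by omega
      have hM := ih c (by omega)
      have hR := ih (c + 1) (by omega)
      push_cast at hR
      rcases Nat.eq_zero_or_pos c with rfl | hpos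
      · have ht : t < w.length := by omega
        simp only [Nat.cast_zero, zero_add] at hM hR ⊢
        rw [M.state_succ_one w ht]
        change g _ (f (v (M.state w t 2)) (v (M.state w t 1))) = _
        change v (M.state w t 2) = _ at hR
        rw [hM, hR, Nat.sub_zero, Nat.add_zero, Nat.sub_zero, Nat.add_zero, hg w t ht,
          hf w t (t + 1) (by omega)]
        simp
      · have hL := ih (c - 1) (by omega)
        have hc1 : ((c - 1 : ℕ) : ℤ) + 1 = (c : ℤ) + 1 - 1 := by omega
        rw [hc1] at hL
        rw [M.state_succ_of_ne_one w t hin (by omega)]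
        change f (f (v _) (v _)) (f (v _) (v _)) = _
        rw [hL, hM, hR, hf w (t + 1 - c) (t + 1 + c) (by omega),
          hf w (t + 1 - c - 1) (t + 1 + c) (by omega),
          hf w (t + 1 - c) (t + 1 + c - 1) (by omega)]
        congr 2
        · congr 1 <;> omega
        · congr 1 <;> omega
        · congr 1 <;> omega
        -- For `t < c` truncated subtraction makes the two second coordinates disagree, but both
        -- points lie in column `0`, where the value is `q₀`.
        · rcases Nat.lt_or_ge t c with h | h
          · have h1 : t - (c - 1) = 0 := by omega
            have h2 : t + 1 - c = 0 := by omega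
            rw [h1, h2, hE0, hE0]
          · congr 1 <;> omega
  refine ⟨M, Set.ext fun w => and_congr_right fun _ => ?_⟩
  have h := key w w.length 0 (by omega)
  change _ ↔ e.symm (v (M.state w w.length 1)) ∈ Acc
  simp only [Nat.cast_zero, zero_add, Nat.sub_zero, Nat.add_zero] at h
  rw [h, Equiv.symm_apply_apply]

/-! ### Least models of formulas -/

/-- The truth of `U` at the position `z` of the half-line `ℕ`, `N - 1` being the last position;
there is none if `N = 0`. -/
def Extremum.HoldsAt (N z : ℕ) : Extremum → Prop
  | .min => z = 0
  | .max => z + 1 = N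

/-- The truth of a hypothesis at the point `(i, j)` of `ℕ × ℕ`. The predicate `none` stands
for `⊥`. -/
def DioHyp.HoldsAt {A : Type*} {P : Type} (w : List A) (N : ℕ) (R : Option P → ℕ → ℕ → Prop)
    (i j : ℕ) : DioHyp A P → Prop
  | .letter s a => w[i - a]? = some s ∧ i = j
  | .pos U v a => U.HoldsAt N (v.value i j - a)
  | .neg U v a => ¬ U.HoldsAt N (v.value i j - a)
  | .comp S a b => R (some S) (i - a) (j - b)
  | .compSwap S b a => R (some S) (j - b) (i - a)

/-- The predicate derived by a clause. -/
def DioConclusion.pred {P : Type} : DioConclusion P → Option P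
  | .atom R => some R
  | .falsum => none

/-- The largest number subtracted in a hypothesis. -/
def DioHyp.depth {A : Type*} {P : Type} : DioHyp A P → ℕ
  | .letter _ a => a
  | .pos _ _ a => a
  | .neg _ _ a => a
  | .comp _ a b => max a b
  | .compSwap _ b a => max a b

theorem DioHyp.HoldsAt.transfer {A : Type*} {P : Type} {w w' : List A} {N N' K i j i' j' : ℕ}
    {R R' : Option P → ℕ → ℕ → Prop} {φ : DioHyp A P} (hφ : φ.depth ≤ K)
    (hletter : ∀ a ≤ K, i = j → w[i - a]? = w'[i' - a]?) (hdiag : i = j → i' = j')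
    (hpos : ∀ (U : Extremum) (v : HornVar), ∀ a ≤ K,
      U.HoldsAt N (v.value i j - a) ↔ U.HoldsAt N' (v.value i' j' - a))
    (hR : ∀ p, ∀ a ≤ K, ∀ b ≤ K, R p (i - a) (j - b) → R' p (i' - a) (j' - b))
    (hR' : ∀ p, ∀ a ≤ K, ∀ b ≤ K, R p (j - b) (i - a) → R' p (j' - b) (i' - a))
    (h : φ.HoldsAt w N R i j) : φ.HoldsAt w' N' R' i' j' := by
  cases φ with
  | letter s a => exact ⟨hletter a hφ h.2 ▸ h.1, hdiag h.2⟩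
  | pos U v a => exact (hpos U v a hφ).1 h
  | neg U v a => exact fun h' => h ((hpos U v a hφ).2 h')
  | comp S a b => exact hR _ a ((le_max_left _ _).trans hφ) b ((le_max_right _ _).trans hφ) h
  | compSwap S b a =>
    exact hR' _ a ((le_max_left _ _).trans hφ) b ((le_max_right _ _).trans hφ) h

theorem DioHyp.HoldsAt.mono {A : Type*} {P : Type} {w : List A} {N i j : ℕ}
    {R R' : Option P → ℕ → ℕ → Prop} (hR : ∀ p i j, R p i j → R' p i j) {φ : DioHyp A P}
    (h : φ.HoldsAt w N R i j) : φ.HoldsAt w N R' i j :=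
  h.transfer le_rfl (fun _ _ _ => rfl) id (fun _ _ _ _ => Iff.rfl)
    (fun _ _ _ _ _ => hR _ _ _) fun _ _ _ _ _ => hR _ _ _

namespace DioFormula

variable {A : Type*} (Φ : DioFormula A)

/-- The interpretations closed under the clauses, in which moreover `⊥` propagates. -/
structure IsModel (w : List A) (N : ℕ) (R : Option Φ.Pred → ℕ → ℕ → Prop) : Prop where
  clause : ∀ C ∈ Φ.clauses, ∀ i j, (∀ φ ∈ C.hyps, φ.HoldsAt w N R i j) → R C.concl.pred i j
  left : ∀ i j, R none i j → R none (i + 1) j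
  right : ∀ i j, R none i j → R none i (j + 1)

/-- The least model. -/
def Der (w : List A) (N : ℕ) (p : Option Φ.Pred) (i j : ℕ) : Prop :=
  ∀ R, Φ.IsModel w N R → R p i j

theorem isModel_der (w : List A) (N : ℕ) : Φ.IsModel w N (Φ.Der w N) where
  clause C hC i j h R hR :=
    hR.clause C hC i j fun φ hφ => (h φ hφ).mono fun _ _ _ h' => h' R hR
  left i j h R hR := hR.left i j (h R hR)
  right i j h R hR := hR.right i j (h R hR)

variable {Φ}

theorem Der.none_mono {w : List A} {N i j i' j' : ℕ} (h : Φ.Der w N none i j) (hi : i ≤ i')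
    (hj : j ≤ j') : Φ.Der w N none i' j' := by
  have h1 : Φ.Der w N none i' j :=
    Nat.le_induction (P := fun i _ => Φ.Der w N none i j) h
      (fun i _ ih => (Φ.isModel_der w N).left i j ih) i' hi
  exact Nat.le_induction (P := fun j _ => Φ.Der w N none i' j) h1
      (fun j _ ih => (Φ.isModel_der w N).right i' j ih) j' hj

theorem exists_depth_le (Φ : DioFormula A) :
    ∃ K, 1 ≤ K ∧ ∀ C ∈ Φ.clauses, ∀ φ ∈ C.hyps, φ.depth ≤ K := by
  obtain ⟨K, hK⟩ := ((Φ.clauses.flatMap DioClause.hyps).map DioHyp.depth).finite_toSet.bddAbove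
  refine ⟨K + 1, by omega, fun C hC φ hφ => (hK ?_).trans K.le_succ⟩
  exact List.mem_map_of_mem (List.mem_flatMap.2 ⟨C, hC, hφ⟩)

theorem holds_iff_holdsAt {P : Type} {w : List A} {R : P → Fin w.length → Fin w.length → Prop}
    {R' : Option P → ℕ → ℕ → Prop} {i j : Fin w.length} (φ : DioHyp A P)
    (hR : ∀ p (i' j' : Fin w.length), R p i' j' ↔ R' (some p) i' j') :
    φ.Holds w R i j ↔ φ.HoldsAt w w.length R' i j := by
  have hpos (U : Extremum) (v : HornVar) (a : ℕ) :
      U.Holds w (WordStructure.sub w (v.value i j) a) ↔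
        U.HoldsAt w.length (v.value (i : ℕ) (j : ℕ) - a) := by
    cases U <;> cases v <;>
      simp [Extremum.Holds, Extremum.HoldsAt, WordStructure.IsMin, WordStructure.IsMax,
        WordStructure.val_sub, HornVar.value]
  cases φ with
  | letter s a =>
    have hi := i.isLt
    have h : (i : ℕ) - a < w.length := by omega
    simp [DioHyp.Holds, DioHyp.HoldsAt, WordStructure.Letter, WordStructure.val_sub,
      List.getElem?_eq_getElem h, Fin.ext_iff]
  | pos U v a => exact hpos U v a
  | neg U v a => exact not_congr (hpos U v a)
  | comp S a b =>
    simp only [DioHyp.Holds, DioHyp.HoldsAt]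
    rw [hR, WordStructure.val_sub, WordStructure.val_sub]
  | compSwap S b a =>
    simp only [DioHyp.Holds, DioHyp.HoldsAt]
    rw [hR, WordStructure.val_sub, WordStructure.val_sub]

/-- A formula is satisfied if and only if `⊥` is not in its least model. -/
theorem satisfied_iff {w : List A} (hw : w ≠ []) :
    Φ.Satisfied w ↔ ¬ Φ.Der w w.length none (w.length - 1) (w.length - 1) := by
  have hn : 0 < w.length := List.length_pos_iff.2 hw
  constructor
  · rintro ⟨R, hR⟩ h
    -- Everything holds outside the square of side `n`. This is harmless, since clauses inside the
    -- square never look outside it.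
    let R' : Option Φ.Pred → ℕ → ℕ → Prop := fun p i j =>
      ∀ (hi : i < w.length) (hj : j < w.length), p.elim False fun p => R p ⟨i, hi⟩ ⟨j, hj⟩
    refine h R' ⟨fun C hC i j hh hi hj => ?_, fun i j hh hi hj => hh (by omega) hj,
      fun i j hh hi hj => hh hi (by omega)⟩ (by omega) (by omega)
    have h' := hR ⟨i, hi⟩ ⟨j, hj⟩ C hC fun φ hφ =>
      (holds_iff_holdsAt (R' := R') φ fun p i' j' => by
        simp [R', i'.isLt, j'.isLt]).2 (hh φ hφ)
    cases hc : C.concl <;> rw [hc] at h' <;> exact h'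
  · intro h
    refine ⟨fun p i j => Φ.Der w w.length (some p) i j, fun i j C hC hh => ?_⟩
    have h' := (Φ.isModel_der w w.length).clause C hC i j fun φ hφ =>
      (holds_iff_holdsAt φ fun p i' j' => Iff.rfl).1 (hh φ hφ)
    cases hc : C.concl with
    | atom p => rw [hc] at h'; exact h'
    | falsum =>
      rw [hc] at h'
      exact h (Der.none_mono h' (by omega) (by omega))

/-- Hypotheses never look at larger coordinates, so derivations at points below `B` can be carried
out below `B`, where `max` is false for both `N` and `N'`. -/
theorem Der.of_lt {w : List A} {N N' B : ℕ} (hN : ∀ z < B, z + 1 ≠ N)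
    (hN' : ∀ z < B, z + 1 ≠ N') {p : Option Φ.Pred} {i j : ℕ} (hi : i < B) (hj : j < B)
    (h : Φ.Der w N p i j) : Φ.Der w N' p i j := by
  refine h (fun p i j => i < B → j < B → Φ.Der w N' p i j)
    ⟨fun C hC i j hh hi hj => ?_,
      fun i j hh hi hj => (Φ.isModel_der w N').left i j (hh (by omega) hj),
      fun i j hh hi hj => (Φ.isModel_der w N').right i j (hh hi (by omega))⟩ hi hj
  refine (Φ.isModel_der w N').clause C hC i j fun φ hφ => (hh φ hφ).transfer le_rfl
    (fun _ _ _ => rfl) id (fun U v a _ => ?_) (fun p a _ b _ h' => h' (by omega) (by omega))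
    fun p a _ b _ h' => h' (by omega) (by omega)
  have hv : v.value i j - a < B := by cases v <;> simp only [HornVar.value] <;> omega
  cases U
  · exact Iff.rfl
  · exact iff_of_false (hN _ hv) (hN' _ hv)

/-! ### Locality of the least model -/

variable (Φ) in
/-- The points `(x, y)` for `w` and `(x', y')` for `w'` cannot be distinguished by the letters and
positions, nor by the parts of the least models preceding these points, within depth `K`. -/
structure Similar (K : ℕ) (w : List A) (N x y : ℕ) (w' : List A) (N' x' y' : ℕ) : Prop where
  diag : x = y → x' = y'
  letter : ∀ a ≤ K, x = y → w[x - a]? = w'[x' - a]?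
  pos_left : ∀ (U : Extremum), ∀ a ≤ K, U.HoldsAt N (x - a) ↔ U.HoldsAt N' (x' - a)
  pos_right : ∀ (U : Extremum), ∀ a ≤ K, U.HoldsAt N (y - a) ↔ U.HoldsAt N' (y' - a)
  der : ∀ p, ∀ a ≤ K, ∀ b ≤ K, ¬ (x - a = x ∧ y - b = y) →
    Φ.Der w N p (x - a) (y - b) → Φ.Der w' N' p (x' - a) (y' - b)
  der_swap : ∀ p, ∀ a ≤ K, ∀ b ≤ K, ¬ (x - a = x ∧ y - b = y) →
    Φ.Der w N p (y - b) (x - a) → Φ.Der w' N' p (y' - b) (x' - a)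

namespace Similar

variable {K : ℕ} {w : List A} {N x y : ℕ} {w' : List A} {N' x' y' : ℕ}

theorem swap (h : Φ.Similar K w N x y w' N' x' y') : Φ.Similar K w N y x w' N' y' x' where
  diag e := (h.diag e.symm).symm
  letter a ha e := by
    have := h.letter a ha e.symm
    rwa [h.diag e.symm, ← e] at this
  pos_left := h.pos_right
  pos_right := h.pos_left
  der p a ha b hb hab := h.der_swap p b hb a ha fun h' => hab h'.symm
  der_swap p a ha b hb hab := h.der p b hb a ha fun h' => hab h'.symm

theorem eq_zero_iff (h : Φ.Similar K w N x y w' N' x' y') : x = 0 ↔ x' = 0 :=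
  h.pos_left .min 0 K.zero_le

/-- At the border `x - a = x` may hold with `a > 0`. Then `x = 0`, hence `x' = 0`, and the shift is
trivial on the other side too. -/
theorem rel (h : Φ.Similar K w N x y w' N' x' y') {R : Option Φ.Pred → ℕ → ℕ → Prop}
    (hR : ∀ p i j, R p i j → Φ.Der w N p i j) (hxy : ∀ p, R p x y → Φ.Der w' N' p x' y')
    (p : Option Φ.Pred) {a : ℕ} (ha : a ≤ K) {b : ℕ} (hb : b ≤ K) (h' : R p (x - a) (y - b)) :
    Φ.Der w' N' p (x' - a) (y' - b) := by
  by_cases hab : x - a = x ∧ y - b = y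
  · have h1 := h.eq_zero_iff
    have h2 := h.swap.eq_zero_iff
    rw [hab.1, hab.2] at h'
    rw [show x' - a = x' by omega, show y' - b = y' by omega]
    exact hxy p h'
  · exact h.der p a ha b hb hab (hR _ _ _ h')

theorem clause (h : Φ.Similar K w N x y w' N' x' y')
    (hK : ∀ C ∈ Φ.clauses, ∀ φ ∈ C.hyps, φ.depth ≤ K) {R : Option Φ.Pred → ℕ → ℕ → Prop}
    (hR : ∀ p i j, R p i j → Φ.Der w N p i j) (hxy : ∀ p, R p x y → Φ.Der w' N' p x' y')
    (hyx : ∀ p, R p y x → Φ.Der w' N' p y' x') {C : DioClause A Φ.Pred} (hC : C ∈ Φ.clauses)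
    (hh : ∀ φ ∈ C.hyps, φ.HoldsAt w N R x y) : Φ.Der w' N' C.concl.pred x' y' := by
  refine (Φ.isModel_der w' N').clause C hC x' y' fun φ hφ => (hh φ hφ).transfer (hK C hC φ hφ)
    h.letter h.diag (fun U v a ha => ?_) (fun p a ha b hb => h.rel hR hxy p ha hb)
    fun p a ha b hb => h.swap.rel hR hyx p hb ha
  cases v
  · exact h.pos_left U a ha
  · exact h.pos_right U a ha

theorem der_none (h : Φ.Similar K w N x y w' N' x' y') (hK : 1 ≤ K) {i j : ℕ}
    (hij : i + 1 = x ∧ j = y ∨ i = x ∧ j + 1 = y) (h' : Φ.Der w N none i j) :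
    Φ.Der w' N' none x' y' := by
  rcases hij with ⟨rfl, rfl⟩ | ⟨rfl, rfl⟩
  · exact (h.der none 1 hK 0 K.zero_le (by omega) h').none_mono (by omega) (by omega)
  · exact (h.der none 0 K.zero_le 1 hK (by omega) h').none_mono (by omega) (by omega)

/-- Clauses may use atoms at `(x, y)` and `(y, x)` themselves, so recursion on coordinates alone is
not enough. Minimality of the least model is applied to derivability strengthened by transfer at
these two mutually dependent points. -/
theorem der_point (h : Φ.Similar K w N x y w' N' x' y') (hK : 1 ≤ K)
    (hdepth : ∀ C ∈ Φ.clauses, ∀ φ ∈ C.hyps, φ.depth ≤ K) (p : Option Φ.Pred)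
    (h' : Φ.Der w N p x y) : Φ.Der w' N' p x' y' := by
  let R : Option Φ.Pred → ℕ → ℕ → Prop := fun p i j => Φ.Der w N p i j ∧
    (i = x → j = y → Φ.Der w' N' p x' y') ∧ (i = y → j = x → Φ.Der w' N' p y' x')
  have hR (p i j) (h : R p i j) : Φ.Der w N p i j := h.1
  have hxy (p) (h : R p x y) : Φ.Der w' N' p x' y' := h.2.1 rfl rfl
  have hyx (p) (h : R p y x) : Φ.Der w' N' p y' x' := h.2.2 rfl rfl
  refine (h' R ⟨fun C hC i j hh => ⟨?_, ?_, ?_⟩, fun i j hh => ⟨?_, ?_, ?_⟩,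
    fun i j hh => ⟨?_, ?_, ?_⟩⟩).2.1 rfl rfl
  · exact (Φ.isModel_der w N).clause C hC i j fun φ hφ => (hh φ hφ).mono hR
  · rintro rfl rfl
    exact h.clause hdepth hR hxy hyx hC hh
  · rintro rfl rfl
    exact h.swap.clause hdepth hR hyx hxy hC hh
  · exact hh.1.none_mono (by omega) le_rfl
  · exact fun h1 h2 => h.der_none hK (.inl ⟨h1, h2⟩) hh.1
  · exact fun h1 h2 => h.swap.der_none hK (.inl ⟨h1, h2⟩) hh.1
  · exact hh.1.none_mono le_rfl (by omega)
  · exact fun h1 h2 => h.der_none hK (.inr ⟨h1, h2⟩) hh.1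
  · exact fun h1 h2 => h.swap.der_none hK (.inr ⟨h1, h2⟩) hh.1

end Similar

/-! ### Windows -/

/-- The last position, if known: for the value `true` of the flag it is the row `y`. -/
def level (l : Bool) (y : ℕ) : ℕ := if l then y + 1 else 0

variable (Φ) in
/-- A bounded part of the least models around the point `(x, y)`: the coordinates up to the bound
`K + 1`, the letters preceding `x`, and the atoms preceding `(x, y)`, both without a last position
and with last position `y`. -/
def window (K : ℕ) (w : List A) (x y : ℕ) :
    Fin (K + 2) × Fin (K + 2) × (Fin (K + 1) → Option A) ×
      (Bool → Option Φ.Pred → Fin (K + 1) → Fin (K + 1) → Prop × Prop) :=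
  (⟨min x (K + 1), by omega⟩, ⟨min y (K + 1), by omega⟩, fun a => w[x - a]?,
    fun l p a b => (Φ.Der w (level l y) p (x - a) (y - b), Φ.Der w (level l y) p (y - b) (x - a)))

variable (Φ) in
/-- Equality of windows. -/
structure SameWindow (K : ℕ) (w : List A) (x y : ℕ) (w' : List A) (x' y' : ℕ) : Prop where
  left : min x (K + 1) = min x' (K + 1)
  right : min y (K + 1) = min y' (K + 1)
  letter : ∀ a ≤ K, w[x - a]? = w'[x' - a]?
  der : ∀ l p, ∀ a ≤ K, ∀ b ≤ K,
    Φ.Der w (level l y) p (x - a) (y - b) ↔ Φ.Der w' (level l y') p (x' - a) (y' - b)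
  der_swap : ∀ l p, ∀ a ≤ K, ∀ b ≤ K,
    Φ.Der w (level l y) p (y - b) (x - a) ↔ Φ.Der w' (level l y') p (y' - b) (x' - a)

theorem window_eq_iff {K : ℕ} {w : List A} {x y : ℕ} {w' : List A} {x' y' : ℕ} :
    Φ.window K w x y = Φ.window K w' x' y' ↔ Φ.SameWindow K w x y w' x' y' := by
  simp only [window, Prod.mk.injEq, Fin.mk.injEq, funext_iff, eq_iff_iff]
  constructor
  · rintro ⟨h1, h2, h3, h4⟩
    exact ⟨h1, h2, fun a ha => h3 ⟨a, by omega⟩,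
      fun l p a ha b hb => (h4 l p ⟨a, by omega⟩ ⟨b, by omega⟩).1,
      fun l p a ha b hb => (h4 l p ⟨a, by omega⟩ ⟨b, by omega⟩).2⟩
  · intro h
    exact ⟨h.left, h.right, fun a => h.letter a (by omega), fun l p a b =>
      ⟨h.der l p a (by omega) b (by omega), h.der_swap l p a (by omega) b (by omega)⟩⟩

namespace SameWindow

variable {K : ℕ} {w : List A} {x y : ℕ} {w' : List A} {x' y' : ℕ}

theorem similar (hxy : x ≤ y) (hxy' : x' ≤ y') (hdiag : x = y ↔ x' = y')
    (left : min x (K + 1) = min x' (K + 1)) (right : min y (K + 1) = min y' (K + 1))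
    (letter : ∀ a ≤ K, w[x - a]? = w'[x' - a]?) (l : Bool)
    (der : ∀ p, ∀ a ≤ K, ∀ b ≤ K, ¬ (x - a = x ∧ y - b = y) →
      (Φ.Der w (level l y) p (x - a) (y - b) → Φ.Der w' (level l y') p (x' - a) (y' - b)))
    (der_swap : ∀ p, ∀ a ≤ K, ∀ b ≤ K, ¬ (x - a = x ∧ y - b = y) →
      (Φ.Der w (level l y) p (y - b) (x - a) → Φ.Der w' (level l y') p (y' - b) (x' - a))) :
    Φ.Similar K w (level l y) x y w' (level l y') x' y' := by
  refine ⟨hdiag.1, fun a ha _ => letter a ha, fun U a ha => ?_, fun U a ha => ?_, der, der_swap⟩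
  · cases U <;> cases l <;> simp [Extremum.HoldsAt, level] <;> omega
  · cases U <;> cases l <;> simp [Extremum.HoldsAt, level] <;> omega

theorem of_preceding (hK : 1 ≤ K) (hdepth : ∀ C ∈ Φ.clauses, ∀ φ ∈ C.hyps, φ.depth ≤ K)
    (hxy : x ≤ y) (hxy' : x' ≤ y') (hdiag : x = y ↔ x' = y')
    (left : min x (K + 1) = min x' (K + 1)) (right : min y (K + 1) = min y' (K + 1))
    (letter : ∀ a ≤ K, w[x - a]? = w'[x' - a]?)
    (der : ∀ l p, ∀ a ≤ K, ∀ b ≤ K, ¬ (x - a = x ∧ y - b = y) →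
      (Φ.Der w (level l y) p (x - a) (y - b) ↔ Φ.Der w' (level l y') p (x' - a) (y' - b)))
    (der_swap : ∀ l p, ∀ a ≤ K, ∀ b ≤ K, ¬ (x - a = x ∧ y - b = y) →
      (Φ.Der w (level l y) p (y - b) (x - a) ↔ Φ.Der w' (level l y') p (y' - b) (x' - a))) :
    Φ.SameWindow K w x y w' x' y' := by
  have h1 (l : Bool) : Φ.Similar K w (level l y) x y w' (level l y') x' y' :=
    similar hxy hxy' hdiag left right letter l
      (fun p a ha b hb h => (der l p a ha b hb h).1)
      fun p a ha b hb h => (der_swap l p a ha b hb h).1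
  have h2 (l : Bool) : Φ.Similar K w' (level l y') x' y' w (level l y) x y :=
    similar hxy' hxy hdiag.symm left.symm right.symm (fun a ha => (letter a ha).symm) l
      (fun p a ha b hb h => (der l p a ha b hb (by omega)).2)
      fun p a ha b hb h => (der_swap l p a ha b hb (by omega)).2
  refine ⟨left, right, letter, fun l p a ha b hb => ⟨?_, ?_⟩, fun l p a ha b hb => ⟨?_, ?_⟩⟩
  · exact (h1 l).rel (fun _ _ _ => id) (fun p => (h1 l).der_point hK hdepth p) p ha hb
  · exact (h2 l).rel (fun _ _ _ => id) (fun p => (h2 l).der_point hK hdepth p) p ha hb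
  · exact (h1 l).swap.rel (fun _ _ _ => id) (fun p => (h1 l).swap.der_point hK hdepth p) p hb ha
  · exact (h2 l).swap.rel (fun _ _ _ => id) (fun p => (h2 l).swap.der_point hK hdepth p) p hb ha

/-- An atom whose first coordinate is below `x` is in the window at `(x - 1, y)`, with the same last
position. Otherwise both coordinates are below `y`, so a last position `y` has no effect and the
version without last position at `(x, y - 1)` supplies it. -/
theorem inner (hK : 1 ≤ K) (hdepth : ∀ C ∈ Φ.clauses, ∀ φ ∈ C.hyps, φ.depth ≤ K)
    (hxy : x < y) (hxy' : x' < y')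
    (h1 : 0 < x → Φ.SameWindow K w (x - 1) y w' (x' - 1) y')
    (h2 : Φ.SameWindow K w x (y - 1) w' x' (y' - 1)) : Φ.SameWindow K w x y w' x' y' := by
  have hl := h2.left
  have hr := h2.right
  have hlow {v : List A} {N z i j : ℕ} {p : Option Φ.Pred} (hN : N = 0 ∨ N = z + 1)
      (hi : i < z) (hj : j < z) : Φ.Der v N p i j ↔ Φ.Der v 0 p i j :=
    ⟨Der.of_lt (B := z) (by omega) (by omega) hi hj,
      Der.of_lt (B := z) (by omega) (by omega) hi hj⟩
  have hlev (l : Bool) (z : ℕ) : level l z = 0 ∨ level l z = z + 1 := by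
    cases l <;> simp [level]
  refine of_preceding hK hdepth hxy.le hxy'.le (by omega) hl (by omega) h2.letter ?_ ?_
  · intro l p a ha b hb hab
    by_cases hxa : x - a = x
    · have := h2.der false p a ha (b - 1) (by omega)
      rw [hlow (hlev l y) (by omega) (by omega), hlow (hlev l y') (by omega) (by omega)]
      rwa [show y - 1 - (b - 1) = y - b by omega, show y' - 1 - (b - 1) = y' - b by omega] at this
    · have := (h1 (by omega)).der l p (a - 1) (by omega) b hb
      rwa [show x - 1 - (a - 1) = x - a by omega, show x' - 1 - (a - 1) = x' - a by omega] at this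
  · intro l p a ha b hb hab
    by_cases hxa : x - a = x
    · have := h2.der_swap false p a ha (b - 1) (by omega)
      rw [hlow (hlev l y) (by omega) (by omega), hlow (hlev l y') (by omega) (by omega)]
      rwa [show y - 1 - (b - 1) = y - b by omega, show y' - 1 - (b - 1) = y' - b by omega] at this
    · have := (h1 (by omega)).der_swap l p (a - 1) (by omega) b hb
      rwa [show x - 1 - (a - 1) = x - a by omega, show x' - 1 - (a - 1) = x' - a by omega] at this

/-- By symmetry one neighbor suffices: atoms at `(x, x - b)` with `b > 0` are the swapped atoms of
the window at `(x - 1, x)`. -/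
theorem diagonal (hK : 1 ≤ K) (hdepth : ∀ C ∈ Φ.clauses, ∀ φ ∈ C.hyps, φ.depth ≤ K)
    (h0 : x = 0 ↔ x' = 0) (h1 : 0 < x → Φ.SameWindow K w (x - 1) x w' (x' - 1) x')
    (hletter : w[x]? = w'[x']?) : Φ.SameWindow K w x x w' x' x' := by
  have hl : min x (K + 1) = min x' (K + 1) := by
    rcases Nat.eq_zero_or_pos x with h | h
    · rw [h, h0.1 h]
    · exact (h1 h).right
  refine of_preceding hK hdepth le_rfl le_rfl (by simp) hl hl ?_ ?_ ?_
  · intro a ha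
    by_cases hxa : x - a = x
    · rwa [hxa, show x' - a = x' by omega]
    · have := (h1 (by omega)).letter (a - 1) (by omega)
      rwa [show x - 1 - (a - 1) = x - a by omega, show x' - 1 - (a - 1) = x' - a by omega] at this
  · intro l p a ha b hb hab
    by_cases hxa : x - a = x
    · have := (h1 (by omega)).der_swap l p (b - 1) (by omega) 0 (by omega)
      rwa [show x - 1 - (b - 1) = x - b by omega, show x' - 1 - (b - 1) = x' - b by omega,
        show x - 0 = x - a by omega, show x' - 0 = x' - a by omega] at this
    · have := (h1 (by omega)).der l p (a - 1) (by omega) b hb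
      rwa [show x - 1 - (a - 1) = x - a by omega, show x' - 1 - (a - 1) = x' - a by omega] at this
  · intro l p a ha b hb hab
    by_cases hxa : x - a = x
    · have := (h1 (by omega)).der l p (b - 1) (by omega) 0 (by omega)
      rwa [show x - 1 - (b - 1) = x - b by omega, show x' - 1 - (b - 1) = x' - b by omega,
        show x - 0 = x - a by omega, show x' - 0 = x' - a by omega] at this
    · have := (h1 (by omega)).der_swap l p (a - 1) (by omega) b hb
      rwa [show x - 1 - (a - 1) = x - a by omega, show x' - 1 - (a - 1) = x' - a by omega] at this

end SameWindow

end DioFormula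

theorem predDioESOHorn_subset_realTimeIA (A : Type*) [Finite A] :
    PredDioESOHorn A ⊆ RealTimeIA A := by
  rintro _ ⟨Φ, rfl⟩
  obtain ⟨K, hK, hdepth⟩ := Φ.exists_depth_le
  have := Φ.finite_pred
  -- Shifting by one frees column `0` for the constant value that becomes the quiescent state.
  let H := fun (w : List A) (x y : ℕ) => if x = 0 then none else some (Φ.window K w (x - 1) (y - 1))
  have hH {w w' : List A} {x x' y y' : ℕ} : H w x y = H w' x' y' ↔
      (x = 0 ↔ x' = 0) ∧ (0 < x → Φ.SameWindow K w (x - 1) (y - 1) w' (x' - 1) (y' - 1)) := by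
    rw [← DioFormula.window_eq_iff]
    simp only [H]
    split_ifs with h h' h' <;> simp [h, h', Nat.pos_iff_ne_zero]
  have key := mem_realTimeIA_of_grid H (fun w w' y y' => by simp [H]) ?_ ?_
    {o | ∀ W ∈ o, ¬ (W.2.2.2 true none 0 0).1}
  · suffices h : Φ.language = {w | w ≠ [] ∧ H w w.length w.length ∈
        {o | ∀ W ∈ o, ¬ (W.2.2.2 true none 0 0).1}} from h ▸ key
    refine Set.ext fun w => and_congr_right fun hw => ?_
    have hn : 0 < w.length := List.length_pos_iff.2 hw
    have hHw : H w w.length w.length = some (Φ.window K w (w.length - 1) (w.length - 1)) :=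
      if_neg hn.ne'
    have hwin : ((Φ.window K w (w.length - 1) (w.length - 1)).2.2.2 true none 0 0).1 ↔
        Φ.Der w w.length none (w.length - 1) (w.length - 1) := by
      simp [DioFormula.window, DioFormula.level, Nat.sub_add_cancel hn]
    rw [Φ.satisfied_iff hw, hHw, ← hwin]
    exact ⟨fun h W hW => Option.some.inj hW ▸ h, fun h => h _ rfl⟩
  · intro w w' x x' y y' hxy hxy' h1 h2
    rw [hH] at h1 h2 ⊢
    refine ⟨h2.1, fun hx => ?_⟩
    have := h2.1
    exact .inner hK hdepth (by omega) (by omega) (fun h => h1.2 (by omega)) (h2.2 hx)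
  · intro w w' x x' hx hx' hl h
    rw [hH] at h ⊢
    exact ⟨by simp, fun _ => .diagonal hK hdepth h.1 h.2 hl⟩

theorem mainTheorem2 (A : Type*) [Finite A] : RealTimeIA A = PredDioESOHorn A :=
  (realTimeIA_subset_predDioESOHorn A).antisymm (predDioESOHorn_subset_realTimeIA A)
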